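/- Let $F$ be a probability distribution on $\mathbb{R}$ that is concentrated on $[0,2]$, has mean $1$, and has a unimodal density with respect to Lebesgue measure, i.e. a density $f:\mathbb{R}\to[0,\infty]$ for which there is $a\in\mathbb{R}$ such that $f$ is (weakly) increasing on $(-\infty,a]$ and (weakly) decreasing on $[a,\infty)$. Then $F\in\mathcal D_2^{\rm U}$; that is, there are random variables $X$ and $Y$ on a common probability space, with arbitrary dependence, each uniformly distributed on $[0,1]$, such that $X+Y$ has distribution $F$. -/

import Mathlib

open MeasureTheory ProbabilityTheory
open scoped ENNReal

/-- `f` is increasing on `(-∞, a]` and decreasing on `[a, ∞)` for some real `a` (in the weak sense).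
Densities take values in `[0, ∞]`, so a density with a pole at its mode is included. -/
def IsUnimodal (f : ℝ → ℝ≥0∞) : Prop :=
  ∃ a : ℝ, MonotoneOn f (Set.Iic a) ∧ AntitoneOn f (Set.Ici a)

/-- The distribution `F` has a unimodal (Lebesgue) density. A unimodal function is Borel
measurable, so measurability need not be required. -/
def HasUnimodalDensity (F : Measure ℝ) : Prop :=
  ∃ f : ℝ → ℝ≥0∞, IsUnimodal f ∧ F = volume.withDensity f

/-- The uniform distribution `U[a,b]`, for `a < b`: normalized Lebesgue measure on `[a,b]`. -/
noncomputable def uniformLaw (a b : ℝ) : Measure ℝ :=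
  ProbabilityTheory.cond volume (Set.Icc a b)

/-- `𝒟ₙ(F₁,…,Fₙ)`: the distributions of `X₁ + ⋯ + Xₙ` where `Xᵢ ∼ Fᵢ` are random variables on a
common probability space, with arbitrary dependence. -/
def sumLaws {n : ℕ} (F : Fin n → Measure ℝ) : Set (Measure ℝ) :=
  {G | ∃ (Ω : Type) (_ : MeasurableSpace Ω) (P : Measure Ω) (_ : IsProbabilityMeasure P)
      (X : Fin n → Ω → ℝ),
      (∀ i, HasLaw (X i) (F i) P) ∧ HasLaw (fun ω => ∑ i, X i ω) G P}

/-- `𝒟ₙᵁ = 𝒟ₙ(U[0,1],…,U[0,1])`. -/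
def uniformSumLaws (n : ℕ) : Set (Measure ℝ) :=
  sumLaws (fun _ : Fin n => uniformLaw 0 1)

/-! The proof is by duality. By the M. Riesz extension theorem and the Riesz representation theorem
on the unit square (`exists_measure_integral_eq`), a coupling exists once `f x + g y + h (x + y) ≥
0` on the square forces the integrals of `f`, `g` (uniform law) and `h` (law `F`) to have a
nonnegative sum. Averaging `f` with `g` and normalizing leaves a pair `(φ, k)` as in `IsDualPair`,
and the claim becomes `0 ≤ ∫ k (x - 1) ∂F`.

Let `K = primitive k`. Integrating the dual inequality against explicit couplings supported on
segments makes `φ` cancel and leaves inequalities for `K` alone: `mode_zero` and `atom`. Together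
they order the difference quotients of `K` with respect to `x ^ 2` (`quotient_le`), so that for each
mode `A` some `l` makes the integral of `q t = k t - 2 * l * t` nonnegative over every interval in
`[-1, 1]` containing `A` (`exists_multiplier`).

The superlevel sets of a unimodal density are such intervals after centering, so the layer cake
formula gives a nonnegative integral of `q` against the centered law. The linear term of `q`
integrates to zero because the mean is `1`. -/

/-- `φ` has mean zero on `[0,1]`, and `(x, w) ↦ φ x + φ w + k (x + w - 1)` is nonnegative on the
unit square. -/
structure IsDualPair (φ k : ℝ → ℝ) : Prop where
  cont_left : Continuous φ
  cont_right : Continuous k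
  mean_zero : ∫ x in (0:ℝ)..1, φ x = 0
  nonneg : ∀ x ∈ Set.Icc (0:ℝ) 1, ∀ w ∈ Set.Icc (0:ℝ) 1, 0 ≤ φ x + φ w + k (x + w - 1)

/-- The primitive of `f` that vanishes at `0`. -/
noncomputable def primitive (f : ℝ → ℝ) (x : ℝ) : ℝ := ∫ t in (0:ℝ)..x, f t

theorem primitive_zero (f : ℝ → ℝ) : primitive f 0 = 0 := by simp [primitive]

theorem primitive_sub {f : ℝ → ℝ} (hf : Continuous f) (x y : ℝ) :
    primitive f y - primitive f x = ∫ t in x..y, f t := by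
  unfold primitive
  exact intervalIntegral.integral_interval_sub_left (hf.intervalIntegrable _ _)
    (hf.intervalIntegrable _ _)

theorem hasDerivAt_primitive {f : ℝ → ℝ} (hf : Continuous f) (x : ℝ) :
    HasDerivAt (primitive f) (f x) x :=
  intervalIntegral.integral_hasDerivAt_right (hf.intervalIntegrable _ _)
    (hf.stronglyMeasurableAtFilter _ _) hf.continuousAt

/-- The average of `f` over a segment, in terms of a primitive; `ρ` is the density of the
projected segment of total mass `ω`. -/
theorem mul_integral_segment {f : ℝ → ℝ} (hf : Continuous f) {x y ρ ω : ℝ}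
    (h : ω = ρ * (y - x)) :
    ω * ∫ t in (0:ℝ)..1, f (x + (y - x) * t) = ρ * (primitive f y - primitive f x) := by
  rw [primitive_sub hf, h, mul_assoc, intervalIntegral.mul_integral_comp_add_mul]
  simp

/-! ### Test couplings on segments and the resulting inequalities for `primitive k` -/

namespace IsDualPair

variable {φ k : ℝ → ℝ}

theorem primitive_one (H : IsDualPair φ k) : primitive φ 1 = 0 := H.mean_zero

/-- Integration of the dual inequality over mass `ω` spread evenly on a segment of the square. The
`ρ`s are signed: negative when the coordinate decreases along the segment. -/
theorem segment (H : IsDualPair φ k) {x₀ w₀ x₁ w₁ : ℝ} (ω ρx ρw ρz : ℝ)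
    (hx₀ : x₀ ∈ Set.Icc (0:ℝ) 1) (hw₀ : w₀ ∈ Set.Icc (0:ℝ) 1)
    (hx₁ : x₁ ∈ Set.Icc (0:ℝ) 1) (hw₁ : w₁ ∈ Set.Icc (0:ℝ) 1) (hω : 0 ≤ ω)
    (hx : ω = ρx * (x₁ - x₀)) (hw : ω = ρw * (w₁ - w₀))
    (hz : ω = ρz * ((x₁ + w₁ - 1) - (x₀ + w₀ - 1))) :
    0 ≤ ρx * (primitive φ x₁ - primitive φ x₀) + ρw * (primitive φ w₁ - primitive φ w₀)
      + ρz * (primitive k (x₁ + w₁ - 1) - primitive k (x₀ + w₀ - 1)) := by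
  have hφ := H.cont_left
  have hk := H.cont_right
  rw [← mul_integral_segment hφ hx, ← mul_integral_segment hφ hw, ← mul_integral_segment hk hz,
    ← mul_add, ← mul_add, ← intervalIntegral.integral_add, ← intervalIntegral.integral_add]
  · refine mul_nonneg hω (intervalIntegral.integral_nonneg zero_le_one fun t ht => ?_)
    have hconv : ∀ {a b : ℝ}, a ∈ Set.Icc (0:ℝ) 1 → b ∈ Set.Icc (0:ℝ) 1 →
        a + (b - a) * t ∈ Set.Icc (0:ℝ) 1 := by
      rintro a b ⟨ha, ha'⟩ ⟨hb, hb'⟩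
      obtain ⟨ht, ht'⟩ := ht
      constructor <;> nlinarith
    have := H.nonneg _ (hconv hx₀ hx₁) _ (hconv hw₀ hw₁)
    convert this using 3
    ring
  all_goals exact Continuous.intervalIntegrable (by fun_prop) _ _

/-- Integration along an antidiagonal segment, on which `x + w - 1 = -a`. -/
theorem antidiagonal (H : IsDualPair φ k) {a x₀ x₁ : ℝ} (h₀ : 0 ≤ x₀) (h₁ : x₁ ≤ 1 - a)
    (h : x₀ ≤ x₁) (ha : 0 ≤ a) :
    0 ≤ (primitive φ x₁ - primitive φ x₀)
      + (primitive φ (1 - a - x₀) - primitive φ (1 - a - x₁)) + (x₁ - x₀) * k (-a) := by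
  have hφ := H.cont_left
  have e : ∫ x in x₀..x₁, φ (1 - a - x) = ∫ x in (1 - a - x₁)..(1 - a - x₀), φ x := by
    simp
  have e' : ∫ _ in x₀..x₁, k (-a) = (x₁ - x₀) * k (-a) := by simp
  rw [primitive_sub hφ, primitive_sub hφ, ← e, ← e', ← intervalIntegral.integral_add,
    ← intervalIntegral.integral_add]
  · refine intervalIntegral.integral_nonneg h fun x hx => ?_
    have := H.nonneg x ⟨by linarith [hx.1], by linarith [hx.2]⟩ (1 - a - x)
      ⟨by linarith [hx.2], by linarith [hx.1]⟩
    convert this using 3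
    ring
  all_goals exact Continuous.intervalIntegrable (by fun_prop) _ _

/-- The law with density proportional to `1/α²` on `[-α, 0]` and to `1/β²` on `[0, β]`. -/
theorem mode_zero (H : IsDualPair φ k) {α β : ℝ} (hα : 0 < α) (hα' : α ≤ 1) (hβ : 0 < β)
    (hβ' : β ≤ 1) : β ^ 2 * primitive k (-α) ≤ α ^ 2 * primitive k β := by
  -- The coupling lives on the triangle with vertices `(0, 1 - α)`, `(1, 0)`, `(β, 1)`. The side
  -- masses `β (1 - α)`, `α (1 - β)`, `α β` make both marginals uniform.
  have s₁ := H.segment (x₀ := 0) (w₀ := 1 - α) (x₁ := 1) (w₁ := 0) (β * (1 - α)) (β * (1 - α))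
    (-β) (β * (1 - α) / α) (by simp) ⟨by linarith, by linarith⟩ (by simp) (by simp)
    (mul_nonneg hβ.le (by linarith)) (by ring) (by ring) (by field_simp; ring)
  have s₂ := H.segment (x₀ := 1) (w₀ := 0) (x₁ := β) (w₁ := 1) (α * (1 - β)) (-α)
    (α * (1 - β)) (α * (1 - β) / β) (by simp) (by simp) ⟨by linarith, by linarith⟩ (by simp)
    (mul_nonneg hα.le (by linarith)) (by ring) (by ring) (by field_simp; ring)
  have s₃ := H.segment (x₀ := β) (w₀ := 1) (x₁ := 0) (w₁ := 1 - α) (α * β) (-α) (-β)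
    (-(α * β / (α + β))) ⟨by linarith, by linarith⟩ (by simp) (by simp)
    ⟨by linarith, by linarith⟩ (by positivity) (by ring) (by ring) (by field_simp; ring)
  simp only [primitive_zero, H.primitive_one, show (0:ℝ) + (1 - α) - 1 = -α by ring,
    show (1:ℝ) + 0 - 1 = 0 by ring, show β + 1 - 1 = β by ring] at s₁ s₂ s₃
  have key : 0 ≤ (α + β - α * β) / (α * β * (α + β)) *
      (α ^ 2 * primitive k β - β ^ 2 * primitive k (-α)) := by
    have := add_nonneg (add_nonneg s₁ s₂) s₃
    refine this.trans_eq ?_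
    field_simp
    ring
  have : 0 < (α + β - α * β) / (α * β * (α + β)) := by
    have : 0 < α + β - α * β := by nlinarith
    positivity
  linarith [nonneg_of_mul_nonneg_right key this]

/-- The law `((c - a) / (c + a)) δ₋ₐ + (2 a / (c + a)) U[-a, c]`. -/
theorem atom (H : IsDualPair φ k) {a c : ℝ} (ha : 0 < a) (hac : a < c) (hc : c ≤ 1) :
    0 ≤ 2 * a * (primitive k c - primitive k (-a)) + (c ^ 2 - a ^ 2) * k (-a) := by
  have hc0 : 0 < c := ha.trans hac
  have ha1 : 0 < 1 - a := by linarith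
  -- As `φ` serves both coordinates, only the sum of the two marginals has to be uniform. The atom
  -- at `-a` comes from the antidiagonal in `s₄`.
  have s₁ := H.segment (x₀ := 1 - a) (w₀ := 0) (x₁ := 1) (w₁ := c) (c ^ 2) (c ^ 2 / a) c
    (c ^ 2 / (a + c)) ⟨by linarith, by linarith⟩ (by simp) (by simp) ⟨by linarith, hc⟩
    (by positivity) (by field_simp; ring) (by ring) (by field_simp; ring)
  have s₂ := H.segment (x₀ := 0) (w₀ := 1 - a) (x₁ := 1) (w₁ := 0) (a * (1 - c)) (a * (1 - c))
    (-(a * (1 - c) / (1 - a))) (1 - c) (by simp) ⟨by linarith, by linarith⟩ (by simp) (by simp)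
    (mul_nonneg ha.le (by linarith)) (by ring) (by field_simp; ring) (by ring)
  have s₃ := H.segment (x₀ := 1) (w₀ := 0) (x₁ := c) (w₁ := 1) (c * (1 - c)) (-c)
    (c * (1 - c)) (1 - c) (by simp) (by simp) ⟨by linarith, by linarith⟩ (by simp)
    (mul_nonneg hc0.le (by linarith)) (by ring) (by ring) (by ring)
  have s₄ := H.antidiagonal (a := a) (x₀ := 0) (x₁ := 1 - a) le_rfl le_rfl ha1.le ha.le
  simp only [primitive_zero, H.primitive_one, show (0:ℝ) + (1 - a) - 1 = -a by ring,
    show 1 - a + (0:ℝ) - 1 = -a by ring, show 1 + c - 1 = c by ring, sub_self, sub_zero,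
    show (1:ℝ) + 0 - 1 = 0 by ring, show c + 1 - 1 = c by ring] at s₁ s₂ s₃ s₄
  have hD : 0 < c + a - a * c := by nlinarith
  -- This weight of the antidiagonal solves `c ^ 2 / a = a * (1 - c) / (1 - a) + r`, which balances
  -- the marginal densities on `[0, 1 - a]` and `[1 - a, 1]`.
  have hr : 0 ≤ (c - a) * (c + a - a * c) / (a * (1 - a)) := by
    have : 0 < c - a := by linarith
    positivity
  have key : 0 ≤ (c + a - a * c) / (a * (a + c)) *
      (2 * a * (primitive k c - primitive k (-a)) + (c ^ 2 - a ^ 2) * k (-a)) := by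
    have := add_nonneg (mul_nonneg zero_le_two (add_nonneg (add_nonneg s₁ s₂) s₃))
      (mul_nonneg hr s₄)
    refine this.trans_eq ?_
    field_simp
    ring
  exact nonneg_of_mul_nonneg_right key (by positivity)

/-- The numerator of the derivative in `a` is exactly the quantity in `atom`. -/
theorem monotoneOn_slope (H : IsDualPair φ k) {c : ℝ} (hc : c ≤ 1) :
    MonotoneOn (fun a => (primitive k c - primitive k (-a)) / (c ^ 2 - a ^ 2)) (Set.Ico 0 c) := by
  have hne : ∀ a ∈ Set.Ico 0 c, c ^ 2 - a ^ 2 ≠ 0 := by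
    rintro a ⟨h0, h1⟩
    nlinarith
  have hder : ∀ a ∈ Set.Ico 0 c, HasDerivAt
      (fun a => (primitive k c - primitive k (-a)) / (c ^ 2 - a ^ 2))
      ((k (-a) * (c ^ 2 - a ^ 2) - (primitive k c - primitive k (-a)) * (-(2 * a))) /
        (c ^ 2 - a ^ 2) ^ 2) a := by
    intro a ha
    have h1 : HasDerivAt (fun a => primitive k c - primitive k (-a)) (k (-a)) a := by
      have := ((hasDerivAt_primitive H.cont_right (-a)).comp a (hasDerivAt_neg a)).const_sub
        (primitive k c)
      simpa using this
    have h2 : HasDerivAt (fun a : ℝ => c ^ 2 - a ^ 2) (-(2 * a)) a := by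
      simpa using (hasDerivAt_pow 2 a).const_sub (c ^ 2)
    exact h1.div h2 (hne a ha)
  refine monotoneOn_of_deriv_nonneg (convex_Ico 0 c)
    (fun a ha => (hder a ha).continuousAt.continuousWithinAt) ?_ ?_
  · rw [interior_Ico]
    exact fun a ha => (hder a (Set.Ioo_subset_Ico_self ha)).differentiableAt.differentiableWithinAt
  · rw [interior_Ico]
    intro a ha
    rw [(hder a (Set.Ioo_subset_Ico_self ha)).deriv]
    have := H.atom ha.1 ha.2 hc
    refine div_nonneg ?_ (sq_nonneg _)
    linarith

theorem slope_le (H : IsDualPair φ k) {a b c : ℝ} (ha : 0 ≤ a) (hab : a ≤ b) (hbc : b < c)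
    (hc : c ≤ 1) : (primitive k c - primitive k (-a)) * (c ^ 2 - b ^ 2) ≤
      (primitive k c - primitive k (-b)) * (c ^ 2 - a ^ 2) := by
  have := H.monotoneOn_slope hc ⟨ha, hab.trans_lt hbc⟩ ⟨ha.trans hab, hbc⟩ hab
  exact (div_le_div_iff₀ (by nlinarith) (by nlinarith)).1 this

theorem mode_zero' (H : IsDualPair φ k) {α β : ℝ} (hα : 0 ≤ α) (hα' : α ≤ 1) (hβ : 0 ≤ β)
    (hβ' : β ≤ 1) : β ^ 2 * primitive k (-α) ≤ α ^ 2 * primitive k β := by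
  rcases hα.eq_or_lt with rfl | hα
  · simp [primitive_zero]
  rcases hβ.eq_or_lt with rfl | hβ
  · simp [primitive_zero]
  exact H.mode_zero hα hα' hβ hβ'

theorem reflect (H : IsDualPair φ k) : IsDualPair (fun x => φ (1 - x)) (fun d => k (-d)) where
  cont_left := by have := H.cont_left; fun_prop
  cont_right := by have := H.cont_right; fun_prop
  mean_zero := by simpa using H.mean_zero
  nonneg x hx w hw := by
    have := H.nonneg (1 - x) ⟨by linarith [hx.2], by linarith [hx.1]⟩ (1 - w)
      ⟨by linarith [hw.2], by linarith [hw.1]⟩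
    rwa [show 1 - x + (1 - w) - 1 = -(x + w - 1) by ring] at this

/-- Comparison of the difference quotients of `primitive k` with respect to `x ↦ x ^ 2`, taken at
the points `-a, x` and `-a, y`. -/
theorem quotient_le (H : IsDualPair φ k) {a x y : ℝ} (ha : 0 ≤ a) (hax : a < x) (hx : x ≤ 1)
    (hy : -1 ≤ y) (hya : y < a) :
    0 ≤ ((primitive k x - primitive k (-a)) * (y ^ 2 - a ^ 2)
      - (primitive k y - primitive k (-a)) * (x ^ 2 - a ^ 2)) * (-a - y) := by
  have hx0 : 0 < x := ha.trans_lt hax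
  have hax2 : 0 < x ^ 2 - a ^ 2 := by nlinarith
  rcases lt_trichotomy y (-a) with h | h | h
  -- The factor `-a - y` has the sign of `y ^ 2 - a ^ 2`, so the claim is a comparison of quotients
  -- cleared of denominators.
  · refine mul_nonneg ?_ (by linarith)
    obtain ⟨b, rfl⟩ : ∃ b, y = -b := ⟨-y, by ring⟩
    have hb : b ≤ 1 := by linarith
    have hab : a < b := by linarith
    rcases lt_or_ge b x with hbx | hbx
    · have := H.slope_le ha hab.le hbx hx
      nlinarith
    · have h1 := H.mode_zero' (by linarith) hb hx0.le hx
      have h2 := H.mode_zero' ha (by linarith) hx0.le hx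
      have h3 : 0 ≤ x ^ 2 * ((primitive k x - primitive k (-a)) * ((-b) ^ 2 - a ^ 2)
          - (primitive k (-b) - primitive k (-a)) * (x ^ 2 - a ^ 2)) := by
        have hb2 : 0 ≤ b ^ 2 - x ^ 2 := by nlinarith
        have := add_nonneg (mul_nonneg (sub_nonneg.2 h1) hax2.le) (mul_nonneg (sub_nonneg.2 h2) hb2)
        refine this.trans_eq ?_
        ring
      exact nonneg_of_mul_nonneg_right h3 (by positivity)
  · subst h; simp
  · refine mul_nonneg_of_nonpos_of_nonpos ?_ (by linarith)
    have ha0 : 0 < a := by linarith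
    rcases lt_or_ge y 0 with hy0 | hy0
    · obtain ⟨b, rfl⟩ : ∃ b, y = -b := ⟨-y, by ring⟩
      have := H.slope_le (a := b) (b := a) (by linarith) (by linarith) hax hx
      nlinarith
    · have h1 := H.mode_zero' ha (by linarith) hy0 (by linarith)
      have h2 := H.mode_zero' ha (by linarith) hx0.le hx
      have h3 : 0 ≤ a ^ 2 * ((primitive k y - primitive k (-a)) * (x ^ 2 - a ^ 2)
          - (primitive k x - primitive k (-a)) * (y ^ 2 - a ^ 2)) := by
        have hy2 : 0 ≤ a ^ 2 - y ^ 2 := by nlinarith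
        have := add_nonneg (mul_nonneg (sub_nonneg.2 h1) hax2.le) (mul_nonneg (sub_nonneg.2 h2) hy2)
        refine this.trans_eq ?_
        ring
      have := nonneg_of_mul_nonneg_right h3 (by positivity)
      linarith

theorem exists_bound {k : ℝ → ℝ} (hk : Continuous k) : ∃ M, ∀ x ∈ Set.Icc (-1:ℝ) 1,
    ∀ y ∈ Set.Icc (-1:ℝ) 1, |primitive k y - primitive k x| ≤ M * |y - x| := by
  obtain ⟨M, hM⟩ := (isCompact_Icc (a := (-1:ℝ)) (b := 1)).exists_bound_of_continuousOn
    hk.continuousOn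
  refine ⟨M, fun x hx y hy => ?_⟩
  rw [primitive_sub hk, ← Real.norm_eq_abs]
  refine intervalIntegral.norm_integral_le_of_norm_le_const fun t ht => hM t ?_
  exact Set.uIcc_subset_Icc hx hy (Set.uIoc_subset_uIcc ht)

/-- A Lagrange multiplier for the constraint that the mean vanishes. -/
theorem exists_multiplier_of_nonpos (H : IsDualPair φ k) {A : ℝ} (hA : -1 ≤ A) (hA' : A ≤ 0) :
    ∃ l : ℝ, (∀ x ∈ Set.Icc A 1, primitive k A - l * A ^ 2 ≤ primitive k x - l * x ^ 2) ∧
      (∀ x ∈ Set.Icc (-1) A, primitive k x - l * x ^ 2 ≤ primitive k A - l * A ^ 2) := by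
  obtain ⟨a, rfl⟩ : ∃ a, A = -a := ⟨-A, by ring⟩
  have ha : 0 ≤ a := by linarith
  have ha1 : a ≤ 1 := by linarith
  rcases ha1.eq_or_lt with rfl | ha1
  -- For `a = 1` no point lies to the right of `a`; a Lipschitz constant of `primitive k` on `[-1,
  -- 1]` serves as multiplier.
  · obtain ⟨M, hM⟩ := exists_bound H.cont_right
    refine ⟨M, fun x hx => ?_, fun x hx => ?_⟩
    · have h1 := H.mode_zero' zero_le_one le_rfl zero_le_one le_rfl
      have h2 := hM (-1) (by simp) x hx
      have h3 := hM 1 (by simp) x hx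
      have hM0 : 0 ≤ M := by simpa using (abs_nonneg _).trans (hM 0 (by simp) 1 (by simp))
      rw [abs_of_nonneg (by linarith [hx.1] : 0 ≤ x - -1), abs_le] at h2
      rw [abs_of_nonpos (by linarith [hx.2] : x - 1 ≤ 0), abs_le] at h3
      have hx1 : 0 ≤ x + 1 := by linarith [hx.1]
      have hx2 : 0 ≤ 1 - x := by linarith [hx.2]
      rcases le_total x 0 with h | h
      · nlinarith [mul_nonneg (mul_nonneg hM0 hx1) (neg_nonneg.2 h)]
      · nlinarith [mul_nonneg (mul_nonneg hM0 hx2) h]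
    · obtain rfl : x = -1 := le_antisymm hx.2 hx.1
      exact le_rfl
  -- Away from `x = ±a`, the conditions on `l` read `σ y ≤ l` for `y < a` and `l ≤ σ x` for `x > a`;
  -- the infimum of `σ` over `(a, 1]` meets both.
  obtain ⟨σ, hσ⟩ : ∃ σ : ℝ → ℝ,
      ∀ x, σ x = (primitive k x - primitive k (-a)) / (x ^ 2 - a ^ 2) := ⟨_, fun _ => rfl⟩
  have hpos : ∀ x, a < x → 0 < x ^ 2 - a ^ 2 := fun x hx => by nlinarith
  have hle : ∀ x ∈ Set.Ioc a 1, ∀ y, -1 ≤ y → y < a → y ≠ -a → σ y ≤ σ x := by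
    rintro x ⟨hax, hx⟩ y hy hya hne
    have := H.quotient_le ha hax hx hy hya
    have h1 := hpos x hax
    rcases lt_or_gt_of_ne hne with h | h
    · have h2 : 0 < y ^ 2 - a ^ 2 := by nlinarith
      rw [hσ y, hσ x, div_le_div_iff₀ h2 h1]
      have := nonneg_of_mul_nonneg_left this (by linarith)
      linarith
    · have h2 : 0 < -(y ^ 2 - a ^ 2) := by nlinarith
      rw [hσ y, hσ x, ← neg_div_neg_eq, div_le_div_iff₀ h2 h1]
      nlinarith
  have hbdd : BddBelow (σ '' Set.Ioc a 1) := by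
    rcases ha.eq_or_lt with rfl | ha
    · refine ⟨σ (-1), ?_⟩
      rintro _ ⟨x, hx, rfl⟩
      exact hle x hx _ le_rfl (by norm_num) (by norm_num)
    · refine ⟨σ 0, ?_⟩
      rintro _ ⟨x, hx, rfl⟩
      exact hle x hx _ (by norm_num) ha (by linarith)
  have hne : (σ '' Set.Ioc a 1).Nonempty := (Set.nonempty_Ioc.2 ha1).image σ
  have hlow : ∀ y, -1 ≤ y → y < a → y ≠ -a → σ y ≤ sInf (σ '' Set.Ioc a 1) := by
    intro y h1 h2 h3
    refine le_csInf hne ?_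
    rintro _ ⟨x, hx, rfl⟩
    exact hle x hx y h1 h2 h3
  refine ⟨sInf (σ '' Set.Ioc a 1), fun x hx => ?_, fun x hx => ?_⟩
  · rcases lt_trichotomy x a with h | rfl | h
    · rcases hx.1.eq_or_lt with h' | h'
      · rw [h']
      have h1 := hlow x (by linarith) h h'.ne'
      have h2 : 0 < -(x ^ 2 - a ^ 2) := by nlinarith
      rw [hσ x, ← neg_div_neg_eq, div_le_iff₀ h2] at h1
      nlinarith
    · have := H.mode_zero' ha hx.2 ha hx.2
      rcases ha.eq_or_lt with rfl | ha
      · simp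
      · have := le_of_mul_le_mul_left this (by positivity)
        nlinarith
    · have h1 := csInf_le hbdd ⟨x, ⟨h, hx.2⟩, rfl⟩
      rw [hσ x, le_div_iff₀ (hpos x h)] at h1
      nlinarith
  · rcases hx.2.eq_or_lt with rfl | h'
    · exact le_rfl
    have h1 := hlow x hx.1 (by linarith) h'.ne
    have h2 : 0 < x ^ 2 - a ^ 2 := by nlinarith
    rw [hσ x, div_le_iff₀ h2] at h1
    nlinarith

theorem primitive_comp_neg (k : ℝ → ℝ) (x : ℝ) :
    primitive (fun d => k (-d)) x = -primitive k (-x) := by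
  unfold primitive
  rw [intervalIntegral.integral_comp_neg, neg_zero, intervalIntegral.integral_symm]

theorem exists_multiplier (H : IsDualPair φ k) {A : ℝ} (hA : -1 ≤ A) (hA' : A ≤ 1) :
    ∃ l : ℝ, (∀ x ∈ Set.Icc A 1, primitive k A - l * A ^ 2 ≤ primitive k x - l * x ^ 2) ∧
      (∀ x ∈ Set.Icc (-1) A, primitive k x - l * x ^ 2 ≤ primitive k A - l * A ^ 2) := by
  rcases le_total A 0 with h | h
  · exact H.exists_multiplier_of_nonpos hA h
  · obtain ⟨l, h1, h2⟩ := H.reflect.exists_multiplier_of_nonpos (A := -A) (by linarith)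
      (by linarith)
    refine ⟨-l, fun x hx => ?_, fun x hx => ?_⟩
    · have := h2 (-x) ⟨by linarith [hx.2], by linarith [hx.1]⟩
      simp only [primitive_comp_neg, neg_neg] at this
      nlinarith
    · have := h1 (-x) ⟨by linarith [hx.2], by linarith [hx.1]⟩
      simp only [primitive_comp_neg, neg_neg] at this
      nlinarith

end IsDualPair

theorem primitive_sub_sq (k : ℝ → ℝ) (hk : Continuous k) (l x y : ℝ) :
    ∫ t in x..y, (k t - 2 * l * t) =
      (primitive k y - l * y ^ 2) - (primitive k x - l * x ^ 2) := by
  rw [intervalIntegral.integral_sub (hk.intervalIntegrable _ _)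
    (Continuous.intervalIntegrable (by fun_prop) _ _), ← primitive_sub hk,
    intervalIntegral.integral_const_mul, integral_id]
  ring

/-! ### Integration against a unimodal density through its level sets -/

/-- A bounded order-connected set is an interval, up to its end points. -/
theorem ae_eq_Ioc_of_ordConnected {s : Set ℝ} (hs : s.OrdConnected) {A : ℝ} (hA : A ∈ s)
    (hb : BddBelow s) (ha : BddAbove s) : s =ᵐ[volume] Set.Ioc (sInf s) (sSup s) := by
  have h1 : Set.Ioo (sInf s) (sSup s) ⊆ s := by
    rintro x ⟨hx1, hx2⟩
    obtain ⟨y, hy, hyx⟩ := exists_lt_of_csInf_lt ⟨A, hA⟩ hx1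
    obtain ⟨z, hz, hxz⟩ := exists_lt_of_lt_csSup ⟨A, hA⟩ hx2
    exact hs.out hy hz ⟨hyx.le, hxz.le⟩
  have h2 : s ⊆ Set.Icc (sInf s) (sSup s) := fun x hx => ⟨csInf_le hb hx, le_csSup ha hx⟩
  refine Filter.EventuallyLE.antisymm ?_ ?_
  · exact (LE.le.eventuallyLE h2).trans Ioc_ae_eq_Icc.symm.le
  · exact Ioo_ae_eq_Ioc.symm.le.trans (LE.le.eventuallyLE h1)

/-- If the integrals of `q` from the mode to the right and from the left to the mode are
nonnegative, then the negative part of `q` is dominated on every level set of a unimodal function. -/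
theorem setLIntegral_neg_le_pos {q : ℝ → ℝ} (hq : Continuous q) {u v A : ℝ}
    (hr : ∀ x ∈ Set.Icc A v, 0 ≤ ∫ t in A..x, q t) (hl : ∀ x ∈ Set.Icc u A, 0 ≤ ∫ t in x..A, q t)
    {s : Set ℝ} (hs : s.OrdConnected) (hA : A ∈ s) (hsub : s ⊆ Set.Icc u v) :
    ∫⁻ x in s, ENNReal.ofReal (-q x) ≤ ∫⁻ x in s, ENNReal.ofReal (q x) := by
  have hb : BddBelow s := bddBelow_Icc.mono hsub
  have ha : BddAbove s := bddAbove_Icc.mono hsub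
  rw [Measure.restrict_congr_set (ae_eq_Ioc_of_ordConnected hs hA hb ha)]
  have hle1 : sInf s ≤ A := csInf_le hb hA
  have hle2 : A ≤ sSup s := le_csSup ha hA
  have h1 : u ≤ sInf s := le_csInf ⟨A, hA⟩ fun x hx => (hsub hx).1
  have h2 : sSup s ≤ v := csSup_le ⟨A, hA⟩ fun x hx => (hsub hx).2
  have hint : 0 ≤ ∫ t in (sInf s)..(sSup s), q t := by
    rw [← intervalIntegral.integral_add_adjacent_intervals (b := A)
      (hq.intervalIntegrable _ _) (hq.intervalIntegrable _ _)]
    exact add_nonneg (hl _ ⟨h1, hle1⟩) (hr _ ⟨hle2, h2⟩)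
  rw [intervalIntegral.integral_of_le (hle1.trans hle2)] at hint
  have hi : IntegrableOn q (Set.Ioc (sInf s) (sSup s)) :=
    (hq.integrableOn_Icc).mono_set Set.Ioc_subset_Icc_self
  rw [integral_eq_lintegral_pos_part_sub_lintegral_neg_part hi, sub_nonneg] at hint
  exact (ENNReal.toReal_le_toReal hi.neg.lintegral_lt_top.ne hi.lintegral_lt_top.ne).1 hint

/-- Layer cake formula for functions with values in `[0, ∞]`. -/
theorem lintegral_mul_eq_lintegral_levelSet {f g : ℝ → ℝ≥0∞} (hf : Measurable f)
    (hg : Measurable g) (s : Set ℝ) :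
    ∫⁻ x in s, g x * f x =
      ∫⁻ t in Set.Ioi (0:ℝ), ∫⁻ x in s, {x | ENNReal.ofReal t < f x}.indicator g x := by
  have hlayer : ∀ y : ℝ≥0∞,
      y = ∫⁻ t in Set.Ioi (0:ℝ), {t | ENNReal.ofReal t < y}.indicator 1 t := by
    intro y
    rw [lintegral_indicator_one (measurableSet_lt ENNReal.measurable_ofReal measurable_const),
      Measure.restrict_apply
        (measurableSet_lt ENNReal.measurable_ofReal measurable_const)]
    induction y with
    | top => simp
    | coe y =>
      have : {t : ℝ | ENNReal.ofReal t < y} ∩ Set.Ioi 0 = Set.Ioo 0 (y : ℝ) := by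
        ext t
        simp only [Set.mem_inter_iff, Set.mem_ofPred_eq, Set.mem_Ioi, Set.mem_Ioo]
        constructor
        · rintro ⟨h1, h2⟩
          refine ⟨h2, ?_⟩
          rwa [← ENNReal.ofReal_coe_nnreal, ENNReal.ofReal_lt_ofReal_iff_of_nonneg h2.le] at h1
        · rintro ⟨h1, h2⟩
          refine ⟨?_, h1⟩
          rwa [← ENNReal.ofReal_coe_nnreal, ENNReal.ofReal_lt_ofReal_iff_of_nonneg h1.le]
      rw [this]
      simp
  have hset : MeasurableSet {p : ℝ × ℝ | ENNReal.ofReal p.2 < f p.1} :=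
    measurableSet_lt (ENNReal.measurable_ofReal.comp measurable_snd) (hf.comp measurable_fst)
  have hmeas : Measurable
      ({p : ℝ × ℝ | ENNReal.ofReal p.2 < f p.1}.indicator (fun p => g p.1)) :=
    (hg.comp measurable_fst).indicator hset
  calc ∫⁻ x in s, g x * f x
      = ∫⁻ x in s, ∫⁻ t in Set.Ioi (0:ℝ),
          {p : ℝ × ℝ | ENNReal.ofReal p.2 < f p.1}.indicator (fun p => g p.1) (x, t) := by
        refine lintegral_congr fun x => ?_
        conv_lhs => rw [hlayer (f x)]
        rw [← lintegral_const_mul _ (measurable_one.indicator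
          (measurableSet_lt ENNReal.measurable_ofReal measurable_const))]
        refine lintegral_congr fun t => ?_
        simp [Set.indicator]
    _ = ∫⁻ t in Set.Ioi (0:ℝ), ∫⁻ x in s,
          {p : ℝ × ℝ | ENNReal.ofReal p.2 < f p.1}.indicator (fun p => g p.1) (x, t) :=
        lintegral_lintegral_swap hmeas.aemeasurable
    _ = _ := rfl

theorem lintegral_neg_mul_le_of_unimodal {q : ℝ → ℝ} (hq : Continuous q) {f : ℝ → ℝ≥0∞}
    (hf : Measurable f) {u v A : ℝ} (hA : A ∈ Set.Icc u v)
    (hmono : MonotoneOn f (Set.Icc u A)) (hanti : AntitoneOn f (Set.Icc A v))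
    (hr : ∀ x ∈ Set.Icc A v, 0 ≤ ∫ t in A..x, q t)
    (hl : ∀ x ∈ Set.Icc u A, 0 ≤ ∫ t in x..A, q t) :
    ∫⁻ x in Set.Icc u v, ENNReal.ofReal (-q x) * f x ≤
      ∫⁻ x in Set.Icc u v, ENNReal.ofReal (q x) * f x := by
  rw [lintegral_mul_eq_lintegral_levelSet hf (by fun_prop),
    lintegral_mul_eq_lintegral_levelSet hf (by fun_prop)]
  refine lintegral_mono fun t => ?_
  have hm : MeasurableSet {x | ENNReal.ofReal t < f x} := measurableSet_lt measurable_const hf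
  simp only [lintegral_indicator hm, Measure.restrict_restrict hm]
  by_cases ht : ENNReal.ofReal t < f A
  · refine setLIntegral_neg_le_pos hq hr hl ⟨?_⟩ ⟨ht, hA⟩ Set.inter_subset_right
    rintro x ⟨hx, hx'⟩ y ⟨hy, hy'⟩ z ⟨hxz, hzy⟩
    refine ⟨?_, hx'.1.trans hxz, hzy.trans hy'.2⟩
    rcases le_total z A with h | h
    · exact lt_of_lt_of_le hx
        (hmono ⟨hx'.1, hxz.trans h⟩ ⟨hx'.1.trans hxz, h⟩ hxz)
    · exact lt_of_lt_of_le hy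
        (hanti ⟨h, hzy.trans hy'.2⟩ ⟨h.trans hzy, hy'.2⟩ hzy)
  · have : {x | ENNReal.ofReal t < f x} ∩ Set.Icc u v = ∅ := by
      ext x
      simp only [Set.mem_inter_iff, Set.mem_ofPred_eq, Set.mem_empty_iff_false, iff_false, not_and]
      intro hx hx'
      refine ht (hx.trans_le ?_)
      rcases le_total x A with h | h
      · exact hmono ⟨hx'.1, h⟩ ⟨hA.1, le_rfl⟩ h
      · exact hanti ⟨le_rfl, hA.2⟩ ⟨h, hx'.2⟩ h
    simp [this]

theorem measurable_of_monotoneOn_antitoneOn {f : ℝ → ℝ≥0∞} {a : ℝ}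
    (h₁ : MonotoneOn f (Set.Iic a)) (h₂ : AntitoneOn f (Set.Ici a)) : Measurable f := by
  refine measurable_of_Ioi fun t => Set.OrdConnected.measurableSet ⟨?_⟩
  rintro x hx y hy z ⟨hxz, hzy⟩
  rcases le_total z a with h | h
  · exact lt_of_lt_of_le (Set.mem_Ioi.1 hx) (h₁ (hxz.trans h) h hxz)
  · exact lt_of_lt_of_le (Set.mem_Ioi.1 hy) (h₂ h (h.trans hzy : a ≤ y) hzy)

/-- Restricted to an interval, a unimodal function is unimodal with a mode in that interval. -/
theorem exists_mode_mem_Icc {f : ℝ → ℝ≥0∞} {a u v : ℝ} (huv : u ≤ v)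
    (h₁ : MonotoneOn f (Set.Iic a)) (h₂ : AntitoneOn f (Set.Ici a)) :
    ∃ A ∈ Set.Icc u v, MonotoneOn f (Set.Icc u A) ∧ AntitoneOn f (Set.Icc A v) := by
  rcases le_total a u with h | h
  · exact ⟨u, ⟨le_rfl, huv⟩, by simp, h₂.mono fun x hx => h.trans hx.1⟩
  rcases le_total v a with h' | h'
  · exact ⟨v, ⟨huv, le_rfl⟩, h₁.mono fun x hx => hx.2.trans h', by simp⟩
  · exact ⟨a, ⟨h, h'⟩, h₁.mono fun x hx => hx.2, h₂.mono fun x hx => hx.1⟩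

theorem IsDualPair.integral_nonneg {φ k : ℝ → ℝ} (H : IsDualPair φ k) (F : Measure ℝ)
    [IsProbabilityMeasure F] (hdensity : HasUnimodalDensity F)
    (hsupport : F (Set.Icc 0 2)ᶜ = 0) (hmean : ∫ x, x ∂F = 1) :
    0 ≤ ∫ x, k (x - 1) ∂F := by
  obtain ⟨f, ⟨a, h₁, h₂⟩, hF⟩ := hdensity
  have hf := measurable_of_monotoneOn_antitoneOn h₁ h₂
  obtain ⟨A, hA, hmono, hanti⟩ := exists_mode_mem_Icc (zero_le_two (α := ℝ)) h₁ h₂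
  have hk := H.cont_right
  obtain ⟨l, hl₁, hl₂⟩ := H.exists_multiplier (A := A - 1) (by linarith [hA.1])
    (by linarith [hA.2])
  have hres : F.restrict (Set.Icc 0 2) = F := Measure.restrict_eq_self_of_ae_mem hsupport
  have hint : ∀ g : ℝ → ℝ, Continuous g → Integrable g F := fun g hg => by
    rw [← hres]
    exact hg.integrableOn_Icc
  -- The subtracted linear term has `F`-integral zero since the mean is `1`.
  set q : ℝ → ℝ := fun x => k (x - 1) - 2 * l * (x - 1) with hq
  have hqc : Continuous q := by fun_prop
  have hqint : ∀ x y, ∫ t in x..y, q t = (primitive k (y - 1) - l * (y - 1) ^ 2)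
      - (primitive k (x - 1) - l * (x - 1) ^ 2) := fun x y => by
    rw [← primitive_sub_sq k hk, ← intervalIntegral.integral_comp_sub_right]
  have hlint : ∀ g : ℝ → ℝ≥0∞, Measurable g →
      ∫⁻ x, g x ∂F = ∫⁻ x in Set.Icc 0 2, g x * f x := fun g hg => by
    conv_lhs => rw [← hres, hF, restrict_withDensity measurableSet_Icc]
    rw [lintegral_withDensity_eq_lintegral_mul _ hf hg]
    simp [mul_comm]
  have hqF : 0 ≤ ∫ x, q x ∂F := by
    rw [integral_eq_lintegral_pos_part_sub_lintegral_neg_part (hint q hqc), sub_nonneg]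
    refine ENNReal.toReal_mono (hint q hqc).lintegral_lt_top.ne ?_
    rw [hlint _ (by fun_prop), hlint _ (by fun_prop)]
    refine lintegral_neg_mul_le_of_unimodal hqc hf hA hmono hanti (fun x hx => ?_) fun x hx => ?_
    · rw [hqint, sub_nonneg]
      exact hl₁ _ ⟨by linarith [hx.1], by linarith [hx.2]⟩
    · rw [hqint, sub_nonneg]
      exact hl₂ _ ⟨by linarith [hx.1], by linarith [hx.2]⟩
  have : ∫ x, q x ∂F = ∫ x, k (x - 1) ∂F := by
    rw [hq, integral_sub (hint _ (by fun_prop)) (hint _ (by fun_prop)), integral_const_mul,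
      integral_sub (hint _ (by fun_prop)) (hint _ (by fun_prop)), hmean]
    simp
  rwa [this] at hqF

/-! ### Duality and construction of the coupling -/

open scoped BoundedContinuousFunction unitInterval

theorem integral_add_nonneg_of_unimodal (F : Measure ℝ)
    [IsProbabilityMeasure F] (hdensity : HasUnimodalDensity F)
    (hsupport : F (Set.Icc 0 2)ᶜ = 0) (hmean : ∫ x, x ∂F = 1) (f g h : ℝ →ᵇ ℝ)
    (hpos : ∀ x ∈ Set.Icc (0:ℝ) 1, ∀ y ∈ Set.Icc (0:ℝ) 1, 0 ≤ f x + g y + h (x + y)) :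
    0 ≤ (∫ x in (0:ℝ)..1, f x) + (∫ x in (0:ℝ)..1, g x) + ∫ x, h x ∂F := by
  set J : ℝ := ((∫ x in (0:ℝ)..1, f x) + ∫ x in (0:ℝ)..1, g x) / 2 with hJ
  -- Averaging the hypothesis over the swap of `x` and `y` replaces `f` and `g` by their mean; `J`
  -- moves the constant into `k`.
  have H : IsDualPair (fun x => (f x + g x) / 2 - J) (fun d => h (1 + d) + 2 * J) := by
    refine ⟨by fun_prop, by fun_prop, ?_, fun x hx w hw => ?_⟩
    · rw [intervalIntegral.integral_sub (Continuous.intervalIntegrable (by fun_prop) _ _)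
        (by simp), intervalIntegral.integral_div, intervalIntegral.integral_add
        (f.continuous.intervalIntegrable _ _) (g.continuous.intervalIntegrable _ _)]
      simp [hJ]
    · have h₁ := hpos x hx w hw
      have h₂ := hpos w hw x hx
      rw [add_comm w x] at h₂
      rw [show 1 + (x + w - 1) = x + w by ring]
      linarith
  have := H.integral_nonneg F hdensity hsupport hmean
  simp only [add_sub_cancel] at this
  rw [integral_add (h.integrable F) (integrable_const _)] at this
  simp only [integral_const, probReal_univ, smul_eq_mul, one_mul] at this
  linarith

theorem integral_uniformLaw (f : ℝ → ℝ) : ∫ x, f x ∂uniformLaw 0 1 = ∫ x in (0:ℝ)..1, f x := by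
  rw [uniformLaw, ProbabilityTheory.cond, integral_smul_measure,
    intervalIntegral.integral_of_le zero_le_one, integral_Icc_eq_integral_Ioc]
  simp

instance : IsProbabilityMeasure (uniformLaw 0 1) :=
  cond_isProbabilityMeasure_of_finite (by simp) (by simp)

/-- `(x, y) ↦ f x + g y + h (x + y)` on the unit square, as a linear function of `(f, g, h)`. -/
noncomputable def marginalSum :
    ((ℝ →ᵇ ℝ) × (ℝ →ᵇ ℝ) × (ℝ →ᵇ ℝ)) →ₗ[ℝ] CompactlySupportedContinuousMap (I × I) ℝ where
  toFun p := CompactlySupportedContinuousMap.continuousMapEquiv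
    ⟨fun z => p.1 z.1 + p.2.1 z.2 + p.2.2 (z.1 + z.2), by fun_prop⟩
  map_add' p q := by
    ext z
    simp
    ring
  map_smul' c p := by
    ext z
    simp
    ring

theorem marginalSum_apply (p : (ℝ →ᵇ ℝ) × (ℝ →ᵇ ℝ) × (ℝ →ᵇ ℝ)) (z : I × I) :
    marginalSum p z = p.1 z.1 + p.2.1 z.2 + p.2.2 (z.1 + z.2) := rfl

/-- The sum of the integrals of `f`, `g` and `h` with respect to `μ`, `ν` and `G`. -/
noncomputable def integralSum (μ ν G : Measure ℝ) [IsFiniteMeasure μ] [IsFiniteMeasure ν]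
    [IsFiniteMeasure G] : ((ℝ →ᵇ ℝ) × (ℝ →ᵇ ℝ) × (ℝ →ᵇ ℝ)) →ₗ[ℝ] ℝ where
  toFun p := ∫ x, p.1 x ∂μ + ∫ x, p.2.1 x ∂ν + ∫ x, p.2.2 x ∂G
  map_add' p q := by
    simp only [Prod.fst_add, Prod.snd_add, BoundedContinuousFunction.add_apply]
    rw [integral_add (p.1.integrable μ) (q.1.integrable μ),
      integral_add (p.2.1.integrable ν) (q.2.1.integrable ν),
      integral_add (p.2.2.integrable G) (q.2.2.integrable G)]
    ring
  map_smul' c p := by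
    simp [integral_const_mul]
    ring

theorem integralSum_apply (μ ν G : Measure ℝ) [IsFiniteMeasure μ] [IsFiniteMeasure ν]
    [IsFiniteMeasure G] (p : (ℝ →ᵇ ℝ) × (ℝ →ᵇ ℝ) × (ℝ →ᵇ ℝ)) :
    integralSum μ ν G p = ∫ x, p.1 x ∂μ + ∫ x, p.2.1 x ∂ν + ∫ x, p.2.2 x ∂G := rfl

/-- A linear functional `L` that is nonnegative wherever `T` takes nonnegative values is the
composition with `T` of integration against a measure. -/
theorem exists_measure_integral_eq {X V : Type*} [TopologicalSpace X] [CompactSpace X] [T2Space X]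
    [MeasurableSpace X] [BorelSpace X] [AddCommGroup V] [Module ℝ V]
    (T : V →ₗ[ℝ] CompactlySupportedContinuousMap X ℝ) (L : V →ₗ[ℝ] ℝ)
    (hL : ∀ v, (∀ x, 0 ≤ T v x) → 0 ≤ L v) (e : V) (he : ∀ x, T e x = 1) :
    ∃ P : Measure X, ∀ v, ∫ x, T v x ∂P = L v := by
  have hker : T.ker ≤ L.ker := fun v hv => by
    rw [LinearMap.mem_ker] at hv ⊢
    refine le_antisymm ?_ (hL v fun x => by simp [hv])
    have := hL (-v) fun x => by simp [hv]
    simpa using this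
  let L' : CompactlySupportedContinuousMap X ℝ →ₗ.[ℝ] ℝ :=
    ⟨LinearMap.range T, (T.ker.liftQ L hker).comp T.quotKerEquivRange.symm.toLinearMap⟩
  have hL' : ∀ v, L' ⟨T v, LinearMap.mem_range_self T v⟩ = L v := fun v => by
    change T.ker.liftQ L hker (T.quotKerEquivRange.symm ⟨T v, LinearMap.mem_range_self T v⟩) = L v
    have : T.quotKerEquivRange.symm ⟨T v, LinearMap.mem_range_self T v⟩ = T.ker.mkQ v := by
      rw [LinearEquiv.symm_apply_eq]
      rfl
    rw [this]
    simp
  let C : PointedCone ℝ (CompactlySupportedContinuousMap X ℝ) :=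
    { carrier := {u | ∀ x, 0 ≤ u x}
      add_mem' := fun {u v} hu hv x => add_nonneg (hu x) (hv x)
      zero_mem' := fun x => le_rfl
      smul_mem' := fun c u hu x => mul_nonneg c.2 (hu x) }
  obtain ⟨Λ, hΛ, hΛ'⟩ := riesz_extension C L' (by
      rintro ⟨_, v, rfl⟩ hv
      rw [hL']
      exact hL v hv) (by
      intro u
      -- The range of `T` contains the constants, so adding `-M` with `M` a lower bound of `u`
      -- brings `u` into the cone.
      obtain ⟨M, hM⟩ := (isCompact_range u.continuous).bddBelow
      refine ⟨⟨T ((-M) • e), LinearMap.mem_range_self _ _⟩, fun x => ?_⟩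
      have := hM ⟨x, rfl⟩
      simpa [he] using this)
  let Λ' : CompactlySupportedContinuousMap X ℝ →ₚ[ℝ] ℝ :=
    PositiveLinearMap.mk₀ Λ fun u hu => hΛ' u fun x => hu x
  refine ⟨RealRMK.rieszMeasure Λ', fun v => ?_⟩
  rw [RealRMK.integral_rieszMeasure]
  exact (hΛ ⟨T v, LinearMap.mem_range_self T v⟩).trans (hL' v)

theorem theorem1 (F : Measure ℝ) [IsProbabilityMeasure F]
    (hdensity : HasUnimodalDensity F)
    (hsupport : F (Set.Icc 0 2)ᶜ = 0)
    (hmean : ∫ x, x ∂F = 1) :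
    F ∈ uniformSumLaws 2 := by
  have one_apply : ∀ x : ℝ, (1 : ℝ →ᵇ ℝ) x = 1 := fun _ => rfl
  obtain ⟨P, hP⟩ := exists_measure_integral_eq marginalSum
    (integralSum (uniformLaw 0 1) (uniformLaw 0 1) F) (fun p hp => by
      rw [integralSum_apply, integral_uniformLaw, integral_uniformLaw]
      exact integral_add_nonneg_of_unimodal F hdensity hsupport hmean _ _ _
        fun x hx y hy => hp (⟨x, hx⟩, ⟨y, hy⟩)) (1, 0, 0) (fun z => by simp [marginalSum_apply])
  simp only [marginalSum_apply, integralSum_apply] at hP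
  have hone := hP (1, 0, 0)
  simp at hone
  have hprob : IsProbabilityMeasure P := by
    refine ⟨?_⟩
    rw [measureReal_def] at hone
    exact (ENNReal.toReal_eq_one_iff _).1 hone
  have hlaw : ∀ {Z : I × I → ℝ} {G : Measure ℝ} [IsProbabilityMeasure G], Continuous Z →
      (∀ f : ℝ →ᵇ ℝ, ∫ z, f (Z z) ∂P = ∫ x, f x ∂G) → HasLaw Z G P := by
    intro Z G _ hZ hf
    refine ⟨hZ.aemeasurable, ?_⟩
    have := Measure.isProbabilityMeasure_map (μ := P) hZ.aemeasurable
    refine ext_of_forall_integral_eq_of_IsFiniteMeasure fun f => ?_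
    rw [integral_map hZ.aemeasurable f.continuous.aestronglyMeasurable]
    exact hf f
  refine ⟨I × I, inferInstance, P, hprob, ![fun z => (z.1 : ℝ), fun z => (z.2 : ℝ)], ?_, ?_⟩
  · intro i
    fin_cases i
    · exact hlaw (continuous_subtype_val.comp continuous_fst) fun f => by simpa using hP (f, 0, 0)
    · exact hlaw (continuous_subtype_val.comp continuous_snd) fun f => by simpa using hP (0, f, 0)
  · simp only [Fin.sum_univ_two]
    exact hlaw ((continuous_subtype_val.comp continuous_fst).add
      (continuous_subtype_val.comp continuous_snd)) fun f => by simpa using hP (0, 0, f)
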